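/- Setting. Let $d,N,K,T\ge 1$ be integers with $K\le N$, and let $0<\delta<1$. There are $N$ products with known feature vectors $x_1,\dots,x_N\in\mathbb{R}^d$ and an unknown $\theta^*\in\mathbb{R}^d$, with $\|\theta^*\|\le 1$, $\|x_i\|\le 1$ and $\mu(i):=x_i^\top\theta^*\in[0,1]$ for all $i$. In each period $t=1,\dots,T$ a set $S_t$ of $K$ products is offered, on the basis of the information available before period $t$, and the indicators $r_{t,i}\in\{0,1\}$, $i\in S_t$, are observed; the variables $r_{t,i}$ are independent across products and periods, those of period $t$ are independent of the information available before period $t$, and $\mathbb{E}[r_{t,i}]=\mu(i)$. The regret is $R(T)=\sum_{t=1}^T\sum_{i\in S^*}\mu(i)-\sum_{t=1}^T\sum_{i\in S_t}\mu(i)$, where $S^*$ is a set of $K$ products that maximizes $\sum_{i\in S}\mu(i)$ over $|S|=K$. The algorithm ConsUCB with input $\alpha$ starts from $A_0=I_{d\times d}$, $b_0=0$. In period $t$ it puts $\theta_t=A_{t-1}^{-1}b_{t-1}$, $A_{t,0}=A_{t-1}$, $S_t=\emptyset$; then for $k=1,\dots,K$ it adds to $S_t$ some product $j$ that maximizes,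 over $i\in[N]\setminus S_t$ (ties broken arbitrarily, using only the information available before period $t$), the score $$p_{t,k}(i)=x_i^\top\theta_t-\alpha\sqrt{x_i^\top A_{t-1}^{-1}x_i}+2\alpha\sqrt{x_i^\top A_{t,k-1}^{-1}x_i},$$ and puts $A_{t,k}=A_{t,k-1}+x_jx_j^\top$. It offers $S_t$, observes $r_{t,i}$ for $i\in S_t$, and puts $A_t=A_{t-1}+\sum_{i\in S_t}x_ix_i^\top$ and $b_t=b_{t-1}+\sum_{i\in S_t}r_{t,i}x_i$. Theorem. If ConsUCB is run with $\alpha=\sqrt{d\ln\left(\frac{1+N+TN}{\delta}\right)}+1$, then with probability at least $1-\delta$ $$R(T)\le K+\alpha K+10\,\alpha\sqrt{dKT\log(KT)}.$$ This bound is $\tilde O(K\sqrt d+d\sqrt{KT})$, and its first part, the fixed cost $K+\alpha K$, is $\tilde O(K\sqrt d)$: there are universal constants $C$ and $p$ such that, for all $d,N,K,T,\delta$ as above and with $L=\ln\frac{1+N+TN}{\delta}$, $$K+\alpha K+10\,\alpha\sqrt{dKT\log(KT)}\le C\,(K\sqrt d+d\sqrt{KT})\,L^p\quad\text{and}\quad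 K+\alpha K\le C\,K\sqrt d\,L^p .$$ -/

import Mathlib

open MeasureTheory ProbabilityTheory

namespace SemiBandit

/-! Products are indexed by `Fin N`, with feature vectors `x i` in Euclidean space `ℝ^d`.
Periods `1, …, T` and selection steps `1, …, K` are numbered `0, …, T - 1` and `0, …, K - 1`.
A realised path consists of the selections `sel t k` (the product picked at step `k` of period `t`)
and of the sales indicators `r t i`; only the values with `t < T` and `k < K` are ever used. -/

/-- Probability `μ(i) = xᵢᵀ θ*` of positive sales of product `i`. -/
noncomputable def mean {d N : ℕ} (x : Fin N → EuclideanSpace ℝ (Fin d))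
    (θ : EuclideanSpace ℝ (Fin d)) (i : Fin N) : ℝ :=
  inner ℝ (x i) θ

/-- The products picked in the first `k` steps of period `t`. -/
def picked {N : ℕ} (sel : ℕ → ℕ → Fin N) (t k : ℕ) : Finset (Fin N) :=
  (Finset.range k).image (sel t)

/-- The outer product `xᵢ xᵢᵀ`. -/
noncomputable def outer {d N : ℕ} (x : Fin N → EuclideanSpace ℝ (Fin d)) (i : Fin N) :
    Matrix (Fin d) (Fin d) ℝ :=
  Matrix.vecMulVec (x i).ofLp (x i).ofLp

/-- The matrix available at the beginning of the period number `t` (counted from `0`):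
the identity at first, then increased by `∑_{i ∈ S_t} xᵢ xᵢᵀ` after each period. -/
noncomputable def designMatrix {d N : ℕ} (x : Fin N → EuclideanSpace ℝ (Fin d)) (K : ℕ)
    (sel : ℕ → ℕ → Fin N) : ℕ → Matrix (Fin d) (Fin d) ℝ
  | 0 => 1
  | t + 1 => designMatrix x K sel t + ∑ i ∈ picked sel t K, outer x i

/-- The vector available at the beginning of the period number `t` (counted from `0`):
zero at first, then increased by `∑_{i ∈ S_t} r_{t,i} xᵢ` after each period. -/
noncomputable def responseVector {d N : ℕ} (x : Fin N → EuclideanSpace ℝ (Fin d)) (K : ℕ)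
    (sel : ℕ → ℕ → Fin N) (r : ℕ → Fin N → ℝ) : ℕ → (Fin d → ℝ)
  | 0 => 0
  | t + 1 => responseVector x K sel r t + ∑ i ∈ picked sel t K, r t i • (x i).ofLp

/-- The matrix during period `t` after `k` selections of that period. -/
noncomputable def stepMatrix {d N : ℕ} (x : Fin N → EuclideanSpace ℝ (Fin d)) (K : ℕ)
    (sel : ℕ → ℕ → Fin N) (t : ℕ) : ℕ → Matrix (Fin d) (Fin d) ℝ
  | 0 => designMatrix x K sel t
  | k + 1 => stepMatrix x K sel t k + outer x (sel t k)

/-- The estimate `θ_t = A⁻¹ b` formed at the beginning of period `t`. -/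
noncomputable def estimate {d N : ℕ} (x : Fin N → EuclideanSpace ℝ (Fin d)) (K : ℕ)
    (sel : ℕ → ℕ → Fin N) (r : ℕ → Fin N → ℝ) (t : ℕ) : Fin d → ℝ :=
  Matrix.mulVec (designMatrix x K sel t)⁻¹ (responseVector x K sel r t)

/-- The width `√(vᵀ A⁻¹ v)`. -/
noncomputable def width {d : ℕ} (A : Matrix (Fin d) (Fin d) ℝ) (v : EuclideanSpace ℝ (Fin d)) : ℝ :=
  √(v.ofLp ⬝ᵥ Matrix.mulVec A⁻¹ v.ofLp)

/-- The conservative score of product `i` in period `t` after `k` selections of that period. -/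
noncomputable def score {d N : ℕ} (x : Fin N → EuclideanSpace ℝ (Fin d)) (K : ℕ) (α : ℝ)
    (sel : ℕ → ℕ → Fin N) (r : ℕ → Fin N → ℝ) (t k : ℕ) (i : Fin N) : ℝ :=
  (x i).ofLp ⬝ᵥ estimate x K sel r t
    - α * width (designMatrix x K sel t) (x i)
    + 2 * α * width (stepMatrix x K sel t k) (x i)

/-- The path obeys the algorithm ConsUCB with input `α` for `T` periods: each selection is a
maximiser of the current score among the products not yet picked in the period. Ties may be
broken in any way. -/
def FollowsConsUCB {d N : ℕ} (x : Fin N → EuclideanSpace ℝ (Fin d)) (K T : ℕ) (α : ℝ)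
    (sel : ℕ → ℕ → Fin N) (r : ℕ → Fin N → ℝ) : Prop :=
  ∀ t < T, ∀ k < K, sel t k ∉ picked sel t k ∧
    ∀ i, i ∉ picked sel t k → score x K α sel r t k i ≤ score x K α sel r t k (sel t k)

/-- `S` is a set of `K` products with the largest total mean. -/
def IsOptimalSet {d N : ℕ} (x : Fin N → EuclideanSpace ℝ (Fin d)) (θ : EuclideanSpace ℝ (Fin d))
    (K : ℕ) (S : Finset (Fin N)) : Prop :=
  S.card = K ∧ ∀ S' : Finset (Fin N), S'.card = K → ∑ i ∈ S', mean x θ i ≤ ∑ i ∈ S, mean x θ i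

/-- The regret of a path over `T` periods, against the product set `S`. -/
noncomputable def regret {d N : ℕ} (x : Fin N → EuclideanSpace ℝ (Fin d))
    (θ : EuclideanSpace ℝ (Fin d)) (K T : ℕ) (S : Finset (Fin N)) (sel : ℕ → ℕ → Fin N) : ℝ :=
  ∑ _t ∈ Finset.range T, ∑ i ∈ S, mean x θ i
    - ∑ t ∈ Finset.range T, ∑ i ∈ picked sel t K, mean x θ i

/-- Boundedness assumptions on the features and on the unknown parameter. -/
structure IsInstance {d N : ℕ} (x : Fin N → EuclideanSpace ℝ (Fin d))
    (θ : EuclideanSpace ℝ (Fin d)) : Prop where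
  norm_param_le : ‖θ‖ ≤ 1
  norm_feature_le : ∀ i, ‖x i‖ ≤ 1
  mean_nonneg : ∀ i, 0 ≤ mean x θ i
  mean_le_one : ∀ i, mean x θ i ≤ 1

/-- The sales indicators `r t i` of the `T` periods: binary, with mean `μ(i)`, independent across
products and periods. `ℱ t` is the information available when the selections of period `t` are
made: it contains all indicators of the earlier periods (and possibly further randomness, used for
instance to break ties), and the indicators of period `t` are independent of it. -/
structure IsSalesProcess {d N : ℕ} {Ω : Type*} {mΩ : MeasurableSpace Ω} (P : Measure Ω)
    (ℱ : Filtration ℕ mΩ) (T : ℕ) (x : Fin N → EuclideanSpace ℝ (Fin d))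
    (θ : EuclideanSpace ℝ (Fin d)) (r : ℕ → Fin N → Ω → ℝ) : Prop where
  binary : ∀ t < T, ∀ i ω, r t i ω = 0 ∨ r t i ω = 1
  observed : ∀ t < T, ∀ i, Measurable[ℱ (t + 1)] (r t i)
  expectation : ∀ t < T, ∀ i, ∫ ω, r t i ω ∂P = mean x θ i
  indep : iIndepFun (fun (q : Fin T × Fin N) ω => r q.1 q.2 ω) P
  indep_past : ∀ t < T, Indep (MeasurableSpace.comap (fun ω i => r t i ω) inferInstance) (ℱ t) P

/-- The random selections `sel` are a run of ConsUCB with input `α`: they use only the information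
available at the beginning of the period, and every path obeys the algorithm. -/
structure IsConsUCBRun {d N : ℕ} {Ω : Type*} {mΩ : MeasurableSpace Ω}
    (ℱ : Filtration ℕ mΩ) (K T : ℕ) (α : ℝ) (x : Fin N → EuclideanSpace ℝ (Fin d))
    (r : ℕ → Fin N → Ω → ℝ) (sel : ℕ → ℕ → Ω → Fin N) : Prop where
  nonanticipating : ∀ t < T, ∀ k < K, Measurable[ℱ t] (sel t k)
  follows : ∀ ω, FollowsConsUCB x K T α (fun t k => sel t k ω) (fun t i => r t i ω)

/-- The input `α = √(d ln((1 + N + T N) / δ)) + 1`. -/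
noncomputable def alpha (d N T : ℕ) (δ : ℝ) : ℝ :=
  √((d : ℝ) * Real.log ((1 + N + T * N) / δ)) + 1

/-- The explicit bound `K + α K + 10 α √(d K T log(K T))`. -/
noncomputable def regretBound (d K T : ℕ) (α : ℝ) : ℝ :=
  K + α * K + 10 * α * √((d : ℝ) * K * T * Real.log (K * T))

end SemiBandit

/-! Write `A_t`, `b_t` for the matrix and response vector at the start of period `t` (counted from
0), `w_t(i)` for the width of product `i` under `A_t`, and `s_t` for the sum of the offered features
weighted by the centred indicators.

Confidence. Since `b_t = s_t + (A_t - I)θ`, the error of `xᵢᵀθ_t` is `xᵢᵀA_t⁻¹s_t - xᵢᵀA_t⁻¹θ`, and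
Cauchy–Schwarz bounds it by `(√(s_tᵀA_t⁻¹s_t) + 1) w_t(i)` (`abs_estimate_sub_mean_le`). The process
`exp(s_tᵀA_t⁻¹s_t) / det A_t` starts at 1 and is a supermartingale: a rank-one update does not
increase its expectation (`lintegral_potential_rankOne_le`), the selections of a period are fixed
before its noise, and that noise is independent across products (`setLIntegral_potential_succ_le`).
Ville's inequality and `log det A_t ≤ d log(1 + Kt)` then make `α w_t(i)` a valid radius for all
periods at once, with probability `1 - δ`.

Regret. On that event the score of a product `i` left out is at least `μ(i) - 2α(w_t(i) -
w_{t+1}(i))`, while the score of a selected product is at most its mean plus `2α` times its width at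
selection. Matching a `K`-set with the selections bounds the regret of a period by the widths paid
at selection plus a difference that telescopes over time (`FollowsConsUCB.period_regret_le`). The
first period is charged `K`; the telescope leaves `2α ∑ w_1(i)`, and because the initial estimate is
zero, the scores of the first period bound it by `αK` plus widths paid in that period
(`FollowsConsUCB.sum_width_one_le`). All widths paid are summed by the elliptical potential argument
(`FollowsConsUCB.sum_widthSum_le`). -/

namespace SemiBandit

/-! ### Rank-one updates of inverses and determinants. -/

section LinearAlgebra

open Matrix

variable {n : Type*} [Fintype n]

lemma posDef_add_vecMulVec {A : Matrix n n ℝ} (hA : A.PosDef) (x : n → ℝ) :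
    (A + vecMulVec x x).PosDef := by
  refine hA.add_posSemidef ?_
  simpa using posSemidef_vecMulVec_self_star x

lemma posDef_add_sum_vecMulVec {ι : Type*} {A : Matrix n n ℝ} (hA : A.PosDef) (x : ι → n → ℝ)
    (s : Finset ι) : (A + ∑ i ∈ s, vecMulVec (x i) (x i)).PosDef := by
  refine hA.add_posSemidef (posSemidef_sum s fun i _ => ?_)
  simpa using posSemidef_vecMulVec_self_star (x i)

variable [DecidableEq n]

/-- The bilinear form `uᵀ A⁻¹ v`. -/
noncomputable def invForm (A : Matrix n n ℝ) (u v : n → ℝ) : ℝ := u ⬝ᵥ A⁻¹ *ᵥ v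

lemma invForm_add_right (A : Matrix n n ℝ) (u v w : n → ℝ) :
    invForm A u (v + w) = invForm A u v + invForm A u w := by
  simp [invForm, mulVec_add, dotProduct_add]

lemma invForm_add_left (A : Matrix n n ℝ) (u v w : n → ℝ) :
    invForm A (u + v) w = invForm A u w + invForm A v w := by
  simp [invForm, add_dotProduct]

lemma invForm_smul_right (A : Matrix n n ℝ) (c : ℝ) (u v : n → ℝ) :
    invForm A u (c • v) = c * invForm A u v := by
  simp [invForm, mulVec_smul, dotProduct_smul]

lemma invForm_smul_left (A : Matrix n n ℝ) (c : ℝ) (u v : n → ℝ) :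
    invForm A (c • u) v = c * invForm A u v := by
  simp [invForm, smul_dotProduct]

lemma invForm_comm {A : Matrix n n ℝ} (hA : A.PosDef) (u v : n → ℝ) :
    invForm A u v = invForm A v u := by
  have h : (A⁻¹)ᵀ = A⁻¹ := by
    simpa [IsHermitian, conjTranspose_eq_transpose_of_trivial] using hA.inv.isHermitian
  rw [invForm, invForm, dotProduct_comm u, ← dotProduct_transpose_mulVec, h, dotProduct_comm]

lemma invForm_self_nonneg {A : Matrix n n ℝ} (hA : A.PosDef) (u : n → ℝ) :
    0 ≤ invForm A u u := by
  simpa [invForm] using hA.inv.posSemidef.dotProduct_mulVec_nonneg u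

/-- Sherman–Morrison, checked by applying `A + x xᵀ` to the right-hand side. -/
lemma mulVec_inv_add_vecMulVec {A : Matrix n n ℝ} (hA : A.PosDef) (x v : n → ℝ) :
    (A + vecMulVec x x)⁻¹ *ᵥ v =
      A⁻¹ *ᵥ v - (invForm A x v / (1 + invForm A x x)) • A⁻¹ *ᵥ x := by
  have hw : (1 + invForm A x x) ≠ 0 := by
    have := invForm_self_nonneg hA x; positivity
  have hU : IsUnit A.det := hA.det_pos.ne'.isUnit
  have hV : IsUnit (A + vecMulVec x x).det := (posDef_add_vecMulVec hA x).det_pos.ne'.isUnit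
  set c := invForm A x v / (1 + invForm A x x) with hc
  have key : (A + vecMulVec x x) *ᵥ (A⁻¹ *ᵥ v - c • A⁻¹ *ᵥ x) = v := by
    have h1 : ∀ y : n → ℝ, vecMulVec x x *ᵥ y = (x ⬝ᵥ y) • x := by
      intro y; ext i
      simp [vecMulVec_mulVec, mul_comm]
    rw [add_mulVec, mulVec_sub, mulVec_smul, mulVec_mulVec, mulVec_mulVec, mul_nonsing_inv _ hU,
      one_mulVec, one_mulVec, h1, dotProduct_sub, dotProduct_smul]
    change v - c • x + (invForm A x v - c • invForm A x x) • x = v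
    have : invForm A x v - c • invForm A x x = c := by
      rw [hc]; simp only [smul_eq_mul]; field_simp; ring
    rw [this]; simp
  nth_rewrite 1 [← key]
  rw [mulVec_mulVec, nonsing_inv_mul _ hV, one_mulVec]

lemma invForm_add_vecMulVec {A : Matrix n n ℝ} (hA : A.PosDef) (x u v : n → ℝ) :
    invForm (A + vecMulVec x x) u v =
      invForm A u v - invForm A x v * invForm A x u / (1 + invForm A x x) := by
  rw [invForm, mulVec_inv_add_vecMulVec hA, dotProduct_sub, dotProduct_smul]
  change invForm A u v - _ • invForm A u x = _
  rw [invForm_comm hA u x, smul_eq_mul]; ring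

lemma invForm_add_vecMulVec_self_le {A : Matrix n n ℝ} (hA : A.PosDef) (x v : n → ℝ) :
    invForm (A + vecMulVec x x) v v ≤ invForm A v v := by
  rw [invForm_add_vecMulVec hA]
  have := invForm_self_nonneg hA x
  have : 0 ≤ invForm A x v * invForm A x v / (1 + invForm A x x) :=
    div_nonneg (mul_self_nonneg _) (by linarith)
  linarith

lemma det_add_vecMulVec {A : Matrix n n ℝ} (hA : A.PosDef) (x : n → ℝ) :
    (A + vecMulVec x x).det = A.det * (1 + invForm A x x) := by
  have hU : IsUnit A.det := hA.det_pos.ne'.isUnit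
  rw [vecMulVec_eq Unit, det_add_replicateCol_mul_replicateRow hU]
  congr 2
  rw [invForm, dotProduct_mulVec]
  simp [Matrix.mul_apply, dotProduct, vecMul]

/-- The update of the quadratic form when both the matrix and the vector move along `x`. -/
lemma invForm_update {A : Matrix n n ℝ} (hA : A.PosDef) (x v : n → ℝ) (c : ℝ) :
    invForm (A + vecMulVec x x) (v + c • x) (v + c • x) =
      invForm A v v - invForm A x v ^ 2 / (1 + invForm A x x)
        + c * (2 * invForm A x v / (1 + invForm A x x))
        + c ^ 2 * (invForm A x x / (1 + invForm A x x)) := by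
  have := invForm_self_nonneg hA x
  rw [invForm_add_vecMulVec hA]
  simp only [invForm_add_right, invForm_add_left, invForm_smul_left, invForm_smul_right,
    invForm_comm hA v x]
  field_simp
  ring

/-- Cauchy–Schwarz for the form `A⁻¹`, from the discriminant of the nonnegative quadratic `s ↦ (u +
s v)ᵀA⁻¹(u + s v)`. -/
lemma abs_invForm_le {A : Matrix n n ℝ} (hA : A.PosDef) (u v : n → ℝ) :
    |invForm A u v| ≤ √(invForm A u u) * √(invForm A v v) := by
  have h : ∀ s : ℝ, 0 ≤ invForm A v v * (s * s) + 2 * invForm A u v * s + invForm A u u := by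
    intro s
    have := invForm_self_nonneg hA (u + s • v)
    simp only [invForm_add_right, invForm_add_left, invForm_smul_left, invForm_smul_right,
      invForm_comm hA v u] at this
    linarith
  have hd := discrim_le_zero h
  rw [discrim] at hd
  rw [← Real.sqrt_mul (invForm_self_nonneg hA u)]
  exact Real.abs_le_sqrt (by nlinarith)

lemma log_det_le {A : Matrix n n ℝ} (hA : A.PosDef) {m : ℝ} (hm : 0 ≤ m)
    (htr : A.trace ≤ Fintype.card n + m) :
    Real.log A.det ≤ Fintype.card n * Real.log (1 + m) := by
  rcases isEmpty_or_nonempty n with hn | hn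
  · simp
  have h1 := hA.isHermitian.det_eq_prod_eigenvalues
  have h2 := hA.isHermitian.trace_eq_sum_eigenvalues
  simp only [RCLike.ofReal_real_eq_id, id_eq] at h1 h2
  have hc : (1 : ℝ) ≤ Fintype.card n := by exact_mod_cast Fintype.card_pos
  rw [h1, Real.log_prod (fun i _ => (hA.eigenvalues_pos i).ne')]
  -- Tangent line of the logarithm at `1 + m`; summed over the eigenvalues it involves only the
  -- trace.
  have h3 : ∀ i, Real.log (hA.isHermitian.eigenvalues i) ≤
      hA.isHermitian.eigenvalues i / (1 + m) - 1 + Real.log (1 + m) := by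
    intro i
    have hp := hA.eigenvalues_pos i
    have := Real.log_le_sub_one_of_pos (div_pos hp (by positivity : 0 < 1 + m))
    rw [Real.log_div hp.ne' (by positivity)] at this
    linarith
  refine (Finset.sum_le_sum fun i _ => h3 i).trans ?_
  rw [Finset.sum_add_distrib, Finset.sum_sub_distrib, ← Finset.sum_div, ← h2]
  simp only [Finset.sum_const, Finset.card_univ, nsmul_eq_mul, mul_one]
  -- `card n + m ≤ card n * (1 + m)` because `card n ≥ 1`.
  have : A.trace / (1 + m) ≤ Fintype.card n := by
    rw [div_le_iff₀ (by positivity)]; nlinarith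
  linarith

lemma invForm_one (u v : n → ℝ) : invForm 1 u v = u ⬝ᵥ v := by simp [invForm]

end LinearAlgebra

/-! ### Finitely valued random variables and freezing under independence. -/

section FinitelyValued

variable {Ω β γ : Type*} {m : MeasurableSpace Ω}

/-- `X` takes finitely many values and all its level sets belong to `m`. -/
def FinMeas (m : MeasurableSpace Ω) (X : Ω → β) : Prop :=
  (Set.range X).Finite ∧ ∀ s : Set β, MeasurableSet[m] (X ⁻¹' s)

lemma FinMeas.of_fiber {X : Ω → β} (hf : (Set.range X).Finite)
    (hm : ∀ b, MeasurableSet[m] (X ⁻¹' {b})) : FinMeas m X := by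
  refine ⟨hf, fun s => ?_⟩
  have : X ⁻¹' s = ⋃ b ∈ Set.range X ∩ s, X ⁻¹' {b} := by
    ext ω; simp
  rw [this]
  exact MeasurableSet.biUnion (hf.inter_of_left s).countable fun b _ => hm b

lemma FinMeas.mono {m' : MeasurableSpace Ω} {X : Ω → β} (h : FinMeas m X) (hm : m ≤ m') :
    FinMeas m' X :=
  ⟨h.1, fun s => hm _ (h.2 s)⟩

lemma FinMeas.const (b : β) : FinMeas m (fun _ : Ω => b) :=
  ⟨(Set.finite_singleton b).subset (by rintro _ ⟨_, rfl⟩; simp), fun s => by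
    by_cases h : b ∈ s <;> simp [h]⟩

lemma FinMeas.comp {X : Ω → β} (h : FinMeas m X) (g : β → γ) : FinMeas m (fun ω => g (X ω)) :=
  ⟨(h.1.image g).subset (by rintro _ ⟨ω, rfl⟩; exact ⟨X ω, ⟨ω, rfl⟩, rfl⟩), fun s => h.2 (g ⁻¹' s)⟩

lemma FinMeas.pi {ι : Type*} [Finite ι] {κ : ι → Type*} {X : ∀ i, Ω → κ i}
    (h : ∀ i, FinMeas m (X i)) : FinMeas m (fun ω i => X i ω) := by
  refine .of_fiber ((Set.Finite.pi' fun i => (h i).1).subset ?_) fun b => ?_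
  · rintro _ ⟨ω, rfl⟩ i
    exact ⟨ω, rfl⟩
  · have : (fun ω i => X i ω) ⁻¹' {b} = ⋂ i, X i ⁻¹' {b i} := by
      ext ω; simp [funext_iff]
    rw [this]
    exact MeasurableSet.iInter fun i => (h i).2 _

lemma FinMeas.prodMk {X : Ω → β} {Y : Ω → γ} (hX : FinMeas m X) (hY : FinMeas m Y) :
    FinMeas m (fun ω => (X ω, Y ω)) := by
  refine .of_fiber ((hX.1.prod hY.1).subset ?_) fun b => ?_
  · rintro _ ⟨ω, rfl⟩
    exact ⟨⟨ω, rfl⟩, ⟨ω, rfl⟩⟩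
  · have : (fun ω => (X ω, Y ω)) ⁻¹' {b} = X ⁻¹' {b.1} ∩ Y ⁻¹' {b.2} := by
      ext ω; simp [Prod.ext_iff]
    rw [this]
    exact (hX.2 _).inter (hY.2 _)

lemma FinMeas.measurable [MeasurableSpace β] {X : Ω → β} (h : FinMeas m X) : Measurable[m] X :=
  fun s _ => h.2 s

lemma FinMeas.of_measurable [MeasurableSpace β] [MeasurableSingletonClass β] {X : Ω → β}
    (hf : (Set.range X).Finite) (hX : Measurable[m] X) : FinMeas m X :=
  .of_fiber hf fun b => hX (measurableSet_singleton b)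

lemma FinMeas.mem {E : Set Ω} (hE : MeasurableSet[m] E) : FinMeas m (fun ω => ω ∈ E) := by
  refine .of_fiber (Set.toFinite _) fun b => ?_
  by_cases hb : b
  · convert hE using 1
    ext ω; simp [hb]
  · convert hE.compl using 1
    ext ω; simp [hb]

/-- Freezing: to bound the expectation of `f X Y` for independent `X`, `Y`, bound the expectation
of `f h Y` for each fixed value `h` of `X`. -/
lemma lintegral_le_of_indep {mΩ : MeasurableSpace Ω} {P : Measure Ω} {m₁ m₂ : MeasurableSpace Ω}
    (h₁ : m₁ ≤ mΩ) (h₂ : m₂ ≤ mΩ) (hind : Indep m₂ m₁ P) {X : Ω → β} {Y : Ω → γ}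
    (hX : FinMeas m₁ X) (hY : FinMeas m₂ Y) {f : β → γ → ENNReal} {g : β → ENNReal}
    (hfg : ∀ ω₀, ∫⁻ ω, f (X ω₀) (Y ω) ∂P ≤ g (X ω₀)) :
    ∫⁻ ω, f (X ω) (Y ω) ∂P ≤ ∫⁻ ω, g (X ω) ∂P := by
  classical
  set R := hX.1.toFinset
  have hone : ∀ b, Measurable[m₁] ((X ⁻¹' {b}).indicator (1 : Ω → ENNReal)) := fun b =>
    (hX.comp (({b} : Set β).indicator (1 : β → ENNReal))).measurable
  have expand : ∀ (F : β → Ω → ENNReal) ω,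
      F (X ω) ω = ∑ b ∈ R, (X ⁻¹' {b}).indicator (1 : Ω → ENNReal) ω * F b ω := by
    intro F ω
    rw [Finset.sum_eq_single (X ω)]
    · simp
    · intro b _ hb
      simp [Set.indicator, hb.symm]
    · intro h; exact absurd (by simp [R]) h
  have hmf : ∀ b, Measurable[m₂] fun ω => f b (Y ω) := fun b => (hY.comp (f b)).measurable
  calc ∫⁻ ω, f (X ω) (Y ω) ∂P
      = ∫⁻ ω, ∑ b ∈ R, (X ⁻¹' {b}).indicator (1 : Ω → ENNReal) ω * f b (Y ω) ∂P :=
        lintegral_congr fun ω => expand (fun b ω => f b (Y ω)) ω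
    _ = ∑ b ∈ R, ∫⁻ ω, (X ⁻¹' {b}).indicator (1 : Ω → ENNReal) ω * f b (Y ω) ∂P :=
        lintegral_finsetSum _ fun b _ => ((hone b).mono h₁ le_rfl).mul ((hmf b).mono h₂ le_rfl)
    _ = ∑ b ∈ R, (∫⁻ ω, (X ⁻¹' {b}).indicator (1 : Ω → ENNReal) ω ∂P) * ∫⁻ ω, f b (Y ω) ∂P :=
        Finset.sum_congr rfl fun b _ =>
          lintegral_mul_eq_lintegral_mul_lintegral_of_independent_measurableSpace h₁ h₂ hind.symm
            (hone b) (hmf b)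
    _ ≤ ∑ b ∈ R, (∫⁻ ω, (X ⁻¹' {b}).indicator (1 : Ω → ENNReal) ω ∂P) * g b := by
        refine Finset.sum_le_sum fun b hb => ?_
        obtain ⟨ω₀, rfl⟩ := hX.1.mem_toFinset.1 hb
        gcongr
        exact hfg ω₀
    _ = ∑ b ∈ R, ∫⁻ ω, (X ⁻¹' {b}).indicator (1 : Ω → ENNReal) ω * g b ∂P :=
        Finset.sum_congr rfl fun b _ => (lintegral_mul_const _ ((hone b).mono h₁ le_rfl)).symm
    _ = ∫⁻ ω, ∑ b ∈ R, (X ⁻¹' {b}).indicator (1 : Ω → ENNReal) ω * g b ∂P :=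
        (lintegral_finsetSum _ fun b _ => ((hone b).mono h₁ le_rfl).mul measurable_const).symm
    _ = ∫⁻ ω, g (X ω) ∂P := lintegral_congr fun ω => (expand (fun b _ => g b) ω).symm

end FinitelyValued

/-! ### The self-normalized potential as a supermartingale. -/

section Potential

open Matrix

variable {n : Type*} [Fintype n] [DecidableEq n]

/-- The self-normalized potential `exp(vᵀ A⁻¹ v) / det A`. -/
noncomputable def potential (A : Matrix n n ℝ) (v : n → ℝ) : ENNReal :=
  ENNReal.ofReal (Real.exp (invForm A v v - Real.log A.det))

variable {Ω : Type*} {mΩ : MeasurableSpace Ω} {P : Measure Ω}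

/-- With `w = xᵀA⁻¹x` and `s = xᵀA⁻¹v`, the exponent changes by `-s²/(1+w) + cη + η² w/(1+w) -
log(1+w)`. The quadratic noise term is paid for by the determinant, as `η² ≤ 1` and `w/(1+w) ≤
log(1+w)`; the linear one is paid for by `-s²/(1+w)` through the moment bound. -/
lemma lintegral_potential_rankOne_le {A : Matrix n n ℝ} (hA : A.PosDef) (v x : n → ℝ) {η : Ω → ℝ}
    (hη : ∀ ω, |η ω| ≤ 1)
    (hmgf : ∀ c : ℝ, ∫⁻ ω, ENNReal.ofReal (Real.exp (c * η ω)) ∂P ≤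
      ENNReal.ofReal (Real.exp (c ^ 2 / 8))) :
    ∫⁻ ω, potential (A + vecMulVec x x) (v + η ω • x) ∂P ≤ potential A v := by
  set w := invForm A x x
  set s := invForm A x v
  set c := 2 * s / (1 + w) with hc
  have hw : 0 ≤ w := invForm_self_nonneg hA x
  have hw1 : 0 < 1 + w := by linarith
  have hlog : w / (1 + w) ≤ Real.log (1 + w) := by
    have := Real.one_sub_inv_le_log_of_pos hw1
    have h2 : w / (1 + w) = 1 - (1 + w)⁻¹ := by field_simp; ring
    linarith
  set a := invForm A v v - Real.log A.det - s ^ 2 / (1 + w) with ha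
  have hpt : ∀ ω, potential (A + vecMulVec x x) (v + η ω • x) ≤
      ENNReal.ofReal (Real.exp a) * ENNReal.ofReal (Real.exp (c * η ω)) := by
    intro ω
    rw [← ENNReal.ofReal_mul (Real.exp_nonneg _), ← Real.exp_add]
    refine ENNReal.ofReal_le_ofReal (Real.exp_le_exp.2 ?_)
    rw [invForm_update hA, det_add_vecMulVec hA, Real.log_mul hA.det_pos.ne' hw1.ne']
    have h1 : η ω ^ 2 ≤ 1 := by
      rw [← sq_abs]; exact pow_le_one₀ (abs_nonneg _) (hη ω)
    have h2 : 0 ≤ w / (1 + w) := by positivity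
    have h3 : η ω ^ 2 * (w / (1 + w)) ≤ w / (1 + w) := mul_le_of_le_one_left h2 h1
    have h4 : η ω * (2 * s / (1 + w)) = c * η ω := by rw [hc]; ring
    change invForm A v v - s ^ 2 / (1 + w) + η ω * (2 * s / (1 + w)) + η ω ^ 2 * (w / (1 + w))
      - (Real.log A.det + Real.log (1 + w)) ≤ a + c * η ω
    rw [h4]
    linarith
  refine (lintegral_mono hpt).trans ?_
  rw [lintegral_const_mul' _ _ ENNReal.ofReal_ne_top]
  refine (mul_le_mul_right (hmgf c) _).trans ?_
  rw [← ENNReal.ofReal_mul (Real.exp_nonneg _), ← Real.exp_add]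
  refine ENNReal.ofReal_le_ofReal (Real.exp_le_exp.2 ?_)
  -- The left side is `s² / (2 (1 + w)²)`.
  have : c ^ 2 / 8 ≤ s ^ 2 / (1 + w) := by
    rw [hc, div_pow, div_div, div_le_div_iff₀ (by positivity) hw1]
    nlinarith [mul_nonneg (sq_nonneg s) hw1.le, mul_nonneg (mul_nonneg (sq_nonneg s) hw1.le) hw]
  rw [ha]; linarith

/-- The vectors are added one at a time: the noise of the new index is independent of the noise
already included, so the latter can be frozen and the rank-one bound applied. -/
lemma lintegral_potential_sum_le {ι : Type*} [IsProbabilityMeasure P] {A : Matrix n n ℝ}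
    (hA : A.PosDef) (v : n → ℝ) (x : ι → n → ℝ) {η : ι → Ω → ℝ} (hind : iIndepFun η P)
    (hfin : ∀ i, FinMeas mΩ (η i)) (hη : ∀ i ω, |η i ω| ≤ 1)
    (hmgf : ∀ i (c : ℝ), ∫⁻ ω, ENNReal.ofReal (Real.exp (c * η i ω)) ∂P ≤
      ENNReal.ofReal (Real.exp (c ^ 2 / 8))) (s : Finset ι) :
    ∫⁻ ω, potential (A + ∑ i ∈ s, vecMulVec (x i) (x i)) (v + ∑ i ∈ s, η i ω • x i) ∂P ≤
      potential A v := by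
  classical
  induction s using Finset.induction_on with
  | empty => simp
  | insert a s ha ih =>
    refine le_trans ?_ ih
    set B := A + ∑ i ∈ s, vecMulVec (x i) (x i)
    have hB : B.PosDef := posDef_add_sum_vecMulVec hA x s
    have hmeas : ∀ t : Finset ι, Measurable fun ω (i : t) => η i ω := fun t =>
      measurable_pi_lambda _ fun i => (hfin i).measurable
    have hfm : ∀ (t : Finset ι) (i : t),
        FinMeas (MeasurableSpace.comap (fun ω (i : t) => η i ω) inferInstance) (η i) := by
      intro t i
      exact .of_measurable (hfin i).1
        ((measurable_pi_apply i).comp (comap_measurable fun ω (i : t) => η i ω))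
    have hI := hind.indepFun_finset {a} s (by simpa using ha) fun i => (hfin i).measurable
    have hX := (FinMeas.pi fun i : s => hfm s i).comp
      fun y => v + ∑ i : s, y i • x i
    have key := lintegral_le_of_indep (hmeas s).comap_le (hmeas {a}).comap_le hI hX
      (FinMeas.pi fun i => hfm {a} i)
      (f := fun u y => potential (B + vecMulVec (x a) (x a))
        (u + y ⟨a, Finset.mem_singleton_self a⟩ • x a)) (g := potential B)
      fun ω₀ => lintegral_potential_rankOne_le hB _ (x a) (hη a) (hmgf a)
    have hsum : ∀ ω, ∑ i : s, η i ω • x i = ∑ i ∈ s, η i ω • x i := fun ω =>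
      Finset.sum_coe_sort s fun i => η i ω • x i
    simp only [hsum] at key
    have hA' : A + (vecMulVec (x a) (x a) + ∑ i ∈ s, vecMulVec (x i) (x i)) =
        B + vecMulVec (x a) (x a) := by
      rw [add_comm (vecMulVec (x a) (x a)), ← add_assoc]
    have hv : ∀ ω, v + (η a ω • x a + ∑ i ∈ s, η i ω • x i) =
        v + ∑ i ∈ s, η i ω • x i + η a ω • x a := fun ω => by
      rw [add_comm (η a ω • x a), ← add_assoc]
    simp only [Finset.sum_insert ha, hA', hv]
    exact key

end Potential

/-! ### Ville's maximal inequality. -/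

section Ville

variable {Ω : Type*} {mΩ : MeasurableSpace Ω} {P : Measure Ω}

lemma mul_measure_add_setLIntegral_le {W : Ω → ENNReal} (hW : Measurable W) (c : ENNReal)
    {U : Set Ω} (hU : MeasurableSet U) :
    c * P (U ∩ {ω | c ≤ W ω}) + ∫⁻ ω in U ∩ {ω | c ≤ W ω}ᶜ, W ω ∂P ≤ ∫⁻ ω in U, W ω ∂P := by
  have hD : MeasurableSet {ω | c ≤ W ω} := measurableSet_le measurable_const hW
  rw [← lintegral_inter_add_sdiff W U hD (μ := P), ← Set.sdiff_eq]
  gcongr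
  rw [← setLIntegral_const]
  exact setLIntegral_mono' (hU.inter hD) fun ω hω => hω.2

/-- Ville's maximal inequality over finitely many periods. -/
lemma mul_measure_exists_le (ℱ : Filtration ℕ mΩ) {W : ℕ → Ω → ENNReal} (c : ENNReal) {T : ℕ}
    (hW : ∀ t ≤ T, Measurable[ℱ t] (W t))
    (hstep : ∀ t < T, ∀ E, MeasurableSet[ℱ t] E →
      ∫⁻ ω in E, W (t + 1) ω ∂P ≤ ∫⁻ ω in E, W t ω ∂P) :
    c * P {ω | ∃ t ≤ T, c ≤ W t ω} ≤ ∫⁻ ω, W 0 ω ∂P := by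
  have hB : ∀ t ≤ T, MeasurableSet[ℱ t] {ω | ∃ s ≤ t, c ≤ W s ω} := by
    intro t ht
    have : {ω | ∃ s ≤ t, c ≤ W s ω} = ⋃ s ∈ Set.Iic t, {ω | c ≤ W s ω} := by ext; simp
    rw [this]
    refine MeasurableSet.biUnion (Set.to_countable _) fun s hs => ?_
    exact ℱ.mono hs _ ((hW s (le_trans hs ht)) measurableSet_Ici)
  -- The process is stopped at its first crossing of `c`: crossed paths contribute at least `c`
  -- each, the others keep their current value, and this total does not grow with `t`.
  have main : ∀ t ≤ T, c * P {ω | ∃ s ≤ t, c ≤ W s ω}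
      + ∫⁻ ω in {ω | ∃ s ≤ t, c ≤ W s ω}ᶜ, W t ω ∂P ≤ ∫⁻ ω, W 0 ω ∂P := by
    intro t
    induction t with
    | zero =>
      intro h
      simpa using mul_measure_add_setLIntegral_le (P := P) ((hW 0 h).mono (ℱ.le 0) le_rfl) c
        MeasurableSet.univ
    | succ t ih =>
      intro h
      have ht : t ≤ T := by omega
      set B := {ω | ∃ s ≤ t, c ≤ W s ω}
      have hsplit : {ω | ∃ s ≤ t + 1, c ≤ W s ω} = B ∪ (Bᶜ ∩ {ω | c ≤ W (t + 1) ω}) := by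
        ext ω
        simp only [Set.mem_ofPred_eq, Set.mem_union, Set.mem_inter_iff, Set.mem_compl_iff, B]
        constructor
        · rintro ⟨s, hs, hle⟩
          by_cases hb : ∃ s ≤ t, c ≤ W s ω
          · exact .inl hb
          · refine .inr ⟨hb, ?_⟩
            obtain rfl | hs' := hs.eq_or_lt
            · exact hle
            · exact absurd ⟨s, by omega, hle⟩ hb
        · rintro (⟨s, hs, hle⟩ | ⟨-, hle⟩)
          · exact ⟨s, by omega, hle⟩
          · exact ⟨t + 1, le_rfl, hle⟩
      have hcompl : (B ∪ (Bᶜ ∩ {ω | c ≤ W (t + 1) ω}))ᶜ = Bᶜ ∩ {ω | c ≤ W (t + 1) ω}ᶜ := by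
        ext ω; simp only [Set.mem_compl_iff, Set.mem_union, Set.mem_inter_iff]; tauto
      rw [hsplit, hcompl]
      calc _ ≤ c * (P B + P (Bᶜ ∩ {ω | c ≤ W (t + 1) ω}))
            + ∫⁻ ω in Bᶜ ∩ {ω | c ≤ W (t + 1) ω}ᶜ, W (t + 1) ω ∂P := by
            gcongr; exact measure_union_le _ _
        _ ≤ c * P B + ∫⁻ ω in Bᶜ, W (t + 1) ω ∂P := by
            rw [mul_add, add_assoc]
            gcongr
            exact mul_measure_add_setLIntegral_le ((hW _ h).mono (ℱ.le _) le_rfl) c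
              (ℱ.le t _ (hB t ht)).compl
        _ ≤ c * P B + ∫⁻ ω in Bᶜ, W t ω ∂P := by
            gcongr 1
            exact hstep t h _ (hB t ht).compl
        _ ≤ _ := ih ht
  exact le_self_add.trans (main T le_rfl)

end Ville

/-! ### Concentration of the noise along a run of the algorithm. -/

section SalesIndicators

variable {d N : ℕ} {x : Fin N → EuclideanSpace ℝ (Fin d)} {K : ℕ} {sel : ℕ → ℕ → Fin N}

lemma posDef_designMatrix (t : ℕ) : (designMatrix x K sel t).PosDef := by
  induction t with
  | zero => exact Matrix.PosDef.one
  | succ t ih => exact posDef_add_sum_vecMulVec ih (fun i => (x i).ofLp) _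

section Concentration

variable {θ : EuclideanSpace ℝ (Fin d)} {T : ℕ} {Ω : Type*} {mΩ : MeasurableSpace Ω}
  {P : Measure Ω} {ℱ : Filtration ℕ mΩ} {r : ℕ → Fin N → Ω → ℝ} {sel : ℕ → ℕ → Ω → Fin N} {α : ℝ}

lemma IsSalesProcess.measurable (h : IsSalesProcess P ℱ T x θ r) {t : ℕ} (ht : t < T) (i : Fin N) :
    Measurable (r t i) :=
  (h.observed t ht i).mono (ℱ.le _) le_rfl

lemma IsSalesProcess.finite_range (h : IsSalesProcess P ℱ T x θ r) {t : ℕ} (ht : t < T)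
    (i : Fin N) : (Set.range (r t i)).Finite := by
  refine (Set.toFinite ({0, 1} : Set ℝ)).subset ?_
  rintro _ ⟨ω, rfl⟩
  simpa using h.binary t ht i ω

lemma IsSalesProcess.abs_sub_mean_le (h : IsSalesProcess P ℱ T x θ r) (hx : IsInstance x θ) {t : ℕ}
    (ht : t < T) (i : Fin N) (ω : Ω) : |r t i ω - mean x θ i| ≤ 1 := by
  have h0 := hx.mean_nonneg i
  have h1 := hx.mean_le_one i
  rw [abs_le]
  rcases h.binary t ht i ω with h | h <;> rw [h] <;> constructor <;> linarith

/-- Hoeffding's lemma for a variable in `[0, 1]`, with variance proxy `1/4`. -/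
lemma IsSalesProcess.lintegral_exp_le [IsProbabilityMeasure P] (h : IsSalesProcess P ℱ T x θ r)
    {t : ℕ} (ht : t < T) (i : Fin N) (c : ℝ) :
    ∫⁻ ω, ENNReal.ofReal (Real.exp (c * (r t i ω - mean x θ i))) ∂P ≤
      ENNReal.ofReal (Real.exp (c ^ 2 / 8)) := by
  have hs := hasSubgaussianMGF_of_mem_Icc (μ := P) (a := 0) (b := 1) (h.measurable ht i).aemeasurable
    (.of_forall fun ω => by rcases h.binary t ht i ω with h | h <;> simp [h])
  rw [h.expectation t ht i] at hs
  rw [← ofReal_integral_eq_lintegral_ofReal (hs.integrable_exp_mul c)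
    (.of_forall fun ω => (Real.exp_pos _).le)]
  refine ENNReal.ofReal_le_ofReal ((hs.mgf_le c).trans (Real.exp_le_exp.2 (le_of_eq ?_)))
  simp
  ring

/-- The sum of the feature vectors offered before period `t`, weighted by the noise. -/
noncomputable def noiseVector (x : Fin N → EuclideanSpace ℝ (Fin d))
    (θ : EuclideanSpace ℝ (Fin d)) (K : ℕ) (sel : ℕ → ℕ → Fin N) (r : ℕ → Fin N → ℝ) (t : ℕ) :
    Fin d → ℝ :=
  responseVector x K sel (fun t i => r t i - mean x θ i) t

lemma IsConsUCBRun.finMeas_picked (hrun : IsConsUCBRun ℱ K T α x r sel) {t : ℕ} (ht : t < T) :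
    FinMeas (ℱ t) (fun ω => picked (fun t k => sel t k ω) t K) := by
  have h1 : FinMeas (ℱ t) (fun ω (k : Fin K) => sel t k ω) := .pi fun k =>
    .of_measurable (Set.toFinite _) (hrun.nonanticipating t ht k k.2)
  convert h1.comp (fun s => Finset.univ.image s) using 2 with ω
  ext i
  simp only [picked, Finset.mem_image, Finset.mem_range, Finset.mem_univ, true_and]
  exact ⟨fun ⟨k, hk, h⟩ => ⟨⟨k, hk⟩, h⟩, fun ⟨k, h⟩ => ⟨k, k.2, h⟩⟩

lemma finMeas_history (hS : IsSalesProcess P ℱ T x θ r) (hrun : IsConsUCBRun ℱ K T α x r sel)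
    {t : ℕ} (ht : t ≤ T) :
    FinMeas (ℱ t) (fun ω => (designMatrix x K (fun t k => sel t k ω) t,
      noiseVector x θ K (fun t k => sel t k ω) (fun t i => r t i ω) t)) := by
  induction t with
  | zero => exact .const ((1 : Matrix (Fin d) (Fin d) ℝ), (0 : Fin d → ℝ))
  | succ t ih =>
    have hlt : t < T := ht
    have hr : FinMeas (ℱ (t + 1)) (fun ω i => r t i ω) := .pi fun i =>
      .of_measurable (hS.finite_range hlt i) (hS.observed t hlt i)
    exact ((((ih hlt.le).prodMk (hrun.finMeas_picked hlt)).mono (ℱ.mono t.le_succ)).prodMk hr).comp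
      fun p => (p.1.1.1 + ∑ i ∈ p.1.2, outer x i,
        p.1.1.2 + ∑ i ∈ p.1.2, (p.2 i - mean x θ i) • (x i).ofLp)

/-- Conditionally on the past, the matrix, the noise vector and the offered set are constants, while
the indicators of period `t` keep their joint law; so the fixed-set bound applies for each value of
the history. -/
lemma setLIntegral_potential_succ_le [IsProbabilityMeasure P] (hx : IsInstance x θ)
    (hS : IsSalesProcess P ℱ T x θ r) (hrun : IsConsUCBRun ℱ K T α x r sel) {t : ℕ} (ht : t < T)
    {E : Set Ω} (hE : MeasurableSet[ℱ t] E) :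
    ∫⁻ ω in E, potential (designMatrix x K (fun t k => sel t k ω) (t + 1))
        (noiseVector x θ K (fun t k => sel t k ω) (fun t i => r t i ω) (t + 1)) ∂P ≤
      ∫⁻ ω in E, potential (designMatrix x K (fun t k => sel t k ω) t)
        (noiseVector x θ K (fun t k => sel t k ω) (fun t i => r t i ω) t) ∂P := by
  classical
  have hEm := ℱ.le t _ hE
  have hr : Measurable (fun ω i => r t i ω) := measurable_pi_lambda _ fun i => hS.measurable ht i
  -- Membership in `E` is made part of the history, so that the integral over `E` is handled by
  -- freezing as well.
  have hX := ((finMeas_history hS hrun ht.le).prodMk (hrun.finMeas_picked ht)).prodMk (FinMeas.mem hE)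
  have hY : FinMeas (MeasurableSpace.comap (fun ω i => r t i ω) inferInstance)
      (fun ω i => r t i ω) := .pi fun i =>
    .of_measurable (hS.finite_range ht i)
      ((measurable_pi_apply i).comp (comap_measurable fun ω i => r t i ω))
  have hind : iIndepFun (fun i ω => r t i ω - mean x θ i) P :=
    (hS.indep.precomp (g := fun i : Fin N => ((⟨t, ht⟩ : Fin T), i))
      (fun i j h => (Prod.ext_iff.1 h).2)).comp (fun i y => y - mean x θ i)
      fun i => measurable_id.sub_const _
  rw [← lintegral_indicator hEm, ← lintegral_indicator hEm]
  have key := lintegral_le_of_indep (ℱ.le t) hr.comap_le (hS.indep_past t ht) hX hY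
    (f := fun h y => if h.2 then potential (h.1.1.1 + ∑ i ∈ h.1.2, outer x i)
      (h.1.1.2 + ∑ i ∈ h.1.2, (y i - mean x θ i) • (x i).ofLp) else 0)
    (g := fun h => if h.2 then potential h.1.1.1 h.1.1.2 else 0) ?_
  · exact key
  · intro ω₀
    by_cases hω : ω₀ ∈ E
    · simp only [hω, if_true]
      exact lintegral_potential_sum_le (posDef_designMatrix t) _ (fun i => (x i).ofLp) hind
        (fun i => (FinMeas.of_measurable (hS.finite_range ht i) (hS.measurable ht i)).comp
          fun y => y - mean x θ i) (fun i ω => hS.abs_sub_mean_le hx ht i ω)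
        (fun i c => hS.lintegral_exp_le ht i c) _
    · simp [hω]

/-- With probability at least `1 - δ` the self-normalized noise is small in all periods. -/
lemma measureReal_noise_le [IsProbabilityMeasure P] (hx : IsInstance x θ)
    (hS : IsSalesProcess P ℱ T x θ r) (hrun : IsConsUCBRun ℱ K T α x r sel) {δ : ℝ} (hδ : 0 < δ) :
    1 - δ ≤ P.real {ω | ∀ t ≤ T,
      invForm (designMatrix x K (fun t k => sel t k ω) t)
        (noiseVector x θ K (fun t k => sel t k ω) (fun t i => r t i ω) t)
        (noiseVector x θ K (fun t k => sel t k ω) (fun t i => r t i ω) t) <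
      Real.log (designMatrix x K (fun t k => sel t k ω) t).det + Real.log (1 / δ)} := by
  set W : ℕ → Ω → ENNReal := fun t ω => potential (designMatrix x K (fun t k => sel t k ω) t)
    (noiseVector x θ K (fun t k => sel t k ω) (fun t i => r t i ω) t) with hWdef
  have hW : ∀ t ≤ T, Measurable[ℱ t] (W t) := fun t ht =>
    ((finMeas_history hS hrun ht).comp fun p => potential p.1 p.2).measurable
  have hville := mul_measure_exists_le (P := P) ℱ (ENNReal.ofReal (1 / δ)) hW
    fun t ht E hE => setLIntegral_potential_succ_le hx hS hrun ht hE
  have hW0 : ∀ ω, W 0 ω = 1 := fun ω => by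
    simp [hWdef, potential, designMatrix, noiseVector, responseVector, invForm]
  simp only [hW0, lintegral_const, measure_univ, mul_one] at hville
  set B := {ω | ∃ t ≤ T, ENNReal.ofReal (1 / δ) ≤ W t ω}
  have hB : MeasurableSet B := by
    have : B = ⋃ s ∈ Set.Iic T, {ω | ENNReal.ofReal (1 / δ) ≤ W s ω} := by ext; simp [B]
    rw [this]
    exact MeasurableSet.biUnion (Set.to_countable _) fun s hs =>
      measurableSet_le measurable_const ((hW s hs).mono (ℱ.le _) le_rfl)
  have hPB : P.real B ≤ δ := by
    have := ENNReal.toReal_mono ENNReal.one_ne_top hville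
    rw [ENNReal.toReal_mul, ENNReal.toReal_ofReal (by positivity), ENNReal.toReal_one] at this
    change 1 / δ * P.real B ≤ 1 at this
    rw [div_mul_eq_mul_div, one_mul, div_le_one hδ] at this
    exact this
  have hset : {ω | ∀ t ≤ T,
      invForm (designMatrix x K (fun t k => sel t k ω) t)
        (noiseVector x θ K (fun t k => sel t k ω) (fun t i => r t i ω) t)
        (noiseVector x θ K (fun t k => sel t k ω) (fun t i => r t i ω) t) <
      Real.log (designMatrix x K (fun t k => sel t k ω) t).det + Real.log (1 / δ)} = Bᶜ := by
    ext ω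
    simp only [B, hWdef, potential, Set.mem_ofPred_eq, Set.mem_compl_iff, not_exists, not_and,
      not_le, ENNReal.ofReal_lt_ofReal_iff (show 0 < 1 / δ by positivity)]
    refine forall₂_congr fun t _ => ?_
    rw [← Real.lt_log_iff_exp_lt (by positivity)]
    constructor <;> intro h <;> linarith
  rw [hset, probReal_compl_eq_one_sub hB]
  linarith

end Concentration

end SalesIndicators

/-! ### Deterministic analysis of a single path. -/

section Path

open Matrix in
lemma invForm_add_sum_vecMulVec_self_le {n ι : Type*} [Fintype n] [DecidableEq n]
    {A : Matrix n n ℝ} (hA : A.PosDef) (x : ι → n → ℝ) (s : Finset ι) (v : n → ℝ) :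
    invForm (A + ∑ i ∈ s, vecMulVec (x i) (x i)) v v ≤ invForm A v v := by
  classical
  induction s using Finset.induction_on with
  | empty => simp
  | insert a s ha ih =>
    rw [Finset.sum_insert ha, add_comm (vecMulVec (x a) (x a)), ← add_assoc]
    exact (invForm_add_vecMulVec_self_le (posDef_add_sum_vecMulVec hA x s) _ _).trans ih

variable {d N : ℕ} {x : Fin N → EuclideanSpace ℝ (Fin d)} {θ : EuclideanSpace ℝ (Fin d)}
  {K T : ℕ} {sel : ℕ → ℕ → Fin N} {r : ℕ → Fin N → ℝ} {α : ℝ} {S : Finset (Fin N)}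

lemma dotProduct_self_ofLp (v : EuclideanSpace ℝ (Fin d)) : v.ofLp ⬝ᵥ v.ofLp = ‖v‖ ^ 2 := by
  rw [EuclideanSpace.real_norm_sq_eq, dotProduct]
  exact Finset.sum_congr rfl fun i _ => (sq _).symm

lemma mean_eq_dotProduct (i : Fin N) : mean x θ i = (x i).ofLp ⬝ᵥ θ.ofLp := by
  simp [mean, EuclideanSpace.inner_eq_star_dotProduct, dotProduct_comm]

lemma invForm_designMatrix_self_le (t : ℕ) (v : Fin d → ℝ) :
    invForm (designMatrix x K sel t) v v ≤ v ⬝ᵥ v := by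
  induction t with
  | zero => exact (invForm_one v v).le
  | succ t ih =>
    exact (invForm_add_sum_vecMulVec_self_le (posDef_designMatrix t) (fun i => (x i).ofLp) _ v).trans
      ih

/-! ### The selections of one period -/

lemma picked_succ (t k : ℕ) : picked sel t (k + 1) = insert (sel t k) (picked sel t k) := by
  rw [picked, Finset.range_add_one, Finset.image_insert, picked]

lemma FollowsConsUCB.injOn (h : FollowsConsUCB x K T α sel r) {t : ℕ} (ht : t < T) :
    Set.InjOn (sel t) (Finset.range K : Set ℕ) := by
  have aux : ∀ j < K, ∀ k < j, sel t k ≠ sel t j := fun j hj k hk he =>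
    (h t ht j hj).1 (Finset.mem_image.2 ⟨k, Finset.mem_range.2 hk, he⟩)
  intro a ha b hb hab
  rw [Finset.coe_range, Set.mem_Iio] at ha hb
  rcases lt_trichotomy a b with hl | hl | hl
  · exact absurd hab (aux b hb a hl)
  · exact hl
  · exact absurd hab.symm (aux a ha b hl)

lemma posDef_stepMatrix (t k : ℕ) : (stepMatrix x K sel t k).PosDef := by
  induction k with
  | zero => exact posDef_designMatrix t
  | succ k ih => exact posDef_add_vecMulVec ih _

lemma FollowsConsUCB.stepMatrix_eq (h : FollowsConsUCB x K T α sel r) {t : ℕ} (ht : t < T) {k : ℕ}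
    (hk : k ≤ K) :
    stepMatrix x K sel t k = designMatrix x K sel t + ∑ i ∈ picked sel t k, outer x i := by
  induction k with
  | zero => simp [stepMatrix, picked]
  | succ k ih =>
    rw [stepMatrix, ih (by omega), picked_succ, Finset.sum_insert (h t ht k hk).1,
      add_comm (outer x _), add_assoc]

lemma FollowsConsUCB.stepMatrix_last (h : FollowsConsUCB x K T α sel r) {t : ℕ} (ht : t < T) :
    stepMatrix x K sel t K = designMatrix x K sel (t + 1) :=
  h.stepMatrix_eq ht le_rfl

lemma width_nonneg (A : Matrix (Fin d) (Fin d) ℝ) (v : EuclideanSpace ℝ (Fin d)) :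
    0 ≤ width A v :=
  Real.sqrt_nonneg _

lemma width_sq {A : Matrix (Fin d) (Fin d) ℝ} (hA : A.PosDef) (v : EuclideanSpace ℝ (Fin d)) :
    width A v ^ 2 = invForm A v.ofLp v.ofLp :=
  Real.sq_sqrt (invForm_self_nonneg hA _)

lemma antitone_width_stepMatrix (t : ℕ) (v : EuclideanSpace ℝ (Fin d)) :
    Antitone fun k => width (stepMatrix x K sel t k) v :=
  antitone_nat_of_succ_le fun k =>
    Real.sqrt_le_sqrt (invForm_add_vecMulVec_self_le (posDef_stepMatrix t k) _ _)

lemma width_stepMatrix_le_norm (t k : ℕ) (v : EuclideanSpace ℝ (Fin d)) :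
    width (stepMatrix x K sel t k) v ≤ ‖v‖ := by
  refine (antitone_width_stepMatrix t v k.zero_le).trans (Real.sqrt_le_iff.2 ⟨norm_nonneg _, ?_⟩)
  rw [← dotProduct_self_ofLp]
  exact invForm_designMatrix_self_le t _

lemma FollowsConsUCB.width_succ_le (h : FollowsConsUCB x K T α sel r) {t : ℕ} (ht : t < T) {k : ℕ}
    (hk : k ≤ K) (v : EuclideanSpace ℝ (Fin d)) :
    width (designMatrix x K sel (t + 1)) v ≤ width (stepMatrix x K sel t k) v := by
  rw [← h.stepMatrix_last ht]
  exact antitone_width_stepMatrix t v hk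

/-- The sum of the widths of the selections of period `t`, at the time of selection. -/
noncomputable def widthSum (x : Fin N → EuclideanSpace ℝ (Fin d)) (K : ℕ) (sel : ℕ → ℕ → Fin N)
    (t : ℕ) : ℝ :=
  ∑ k ∈ Finset.range K, width (stepMatrix x K sel t k) (x (sel t k))

/-- If a set `S` of `K` elements is compared with the values of an injective sequence of length
`K`, the common elements being matched with themselves, then the sums compare. -/
lemma sum_le_sum_range_of_exchange {ι : Type*} [DecidableEq ι] {S : Finset ι} {s : ℕ → ι}
    (hcard : S.card = K) (hinj : Set.InjOn s (Finset.range K : Set ℕ)) {f : ι → ℝ} {g : ℕ → ℝ}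
    (hout : ∀ i ∈ S, i ∉ (Finset.range K).image s → ∀ k < K, f i ≤ g k)
    (hin : ∀ k < K, s k ∈ S → f (s k) ≤ g k) :
    ∑ i ∈ S, f i ≤ ∑ k ∈ Finset.range K, g k := by
  set F := (Finset.range K).image s
  set I := (Finset.range K).filter fun k => s k ∈ S
  set J := (Finset.range K).filter fun k => ¬ s k ∈ S
  have hsub : I ⊆ Finset.range K := Finset.filter_subset _ _
  have himage : S ∩ F = I.image s := by
    ext i
    simp only [F, I, Finset.mem_inter, Finset.mem_image, Finset.mem_filter]
    constructor
    · rintro ⟨hi, k, hk, rfl⟩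
      exact ⟨k, ⟨hk, hi⟩, rfl⟩
    · rintro ⟨k, ⟨hk, hi⟩, rfl⟩
      exact ⟨hi, k, hk, rfl⟩
  have hinjI : Set.InjOn s (I : Set ℕ) := hinj.mono (Finset.coe_subset.2 hsub)
  -- As many elements of `S` are missed as there are steps landing outside `S`. Since `hout` holds
  -- for every pair, it then suffices to compare the largest missed value with each such step.
  have hcardJ : (S \ F).card = J.card := by
    have h1 := Finset.card_sdiff_add_card_inter S F
    have h2 : I.card + J.card = K := by
      simpa using Finset.card_filter_add_card_filter_not (s := Finset.range K) (fun k => s k ∈ S)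
    rw [himage, Finset.card_image_of_injOn hinjI] at h1
    omega
  rw [← Finset.sum_inter_add_sum_sdiff S F,
    ← Finset.sum_filter_add_sum_filter_not (Finset.range K) fun k => s k ∈ S, himage,
    Finset.sum_image hinjI]
  refine add_le_add (Finset.sum_le_sum fun k hk => ?_) ?_
  · obtain ⟨h1, h2⟩ := Finset.mem_filter.1 hk
    exact hin k (Finset.mem_range.1 h1) h2
  · rcases (S \ F).eq_empty_or_nonempty with he | hne
    · rw [he, Finset.card_empty, eq_comm, Finset.card_eq_zero] at hcardJ
      rw [he]
      change _ ≤ ∑ k ∈ J, g k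
      simp [hcardJ]
    · obtain ⟨i, hi, hmax⟩ := Finset.exists_max_image (S \ F) f hne
      obtain ⟨h1, h2⟩ := Finset.mem_sdiff.1 hi
      calc ∑ i ∈ S \ F, f i ≤ (S \ F).card • f i := Finset.sum_le_card_nsmul _ _ _ hmax
        _ = J.card • f i := by rw [hcardJ]
        _ ≤ ∑ k ∈ J, g k := Finset.card_nsmul_le_sum _ _ _ fun k hk =>
          hout i h1 h2 k (Finset.mem_range.1 (Finset.mem_filter.1 hk).1)

lemma picked_mono {t k l : ℕ} (h : k ≤ l) : picked sel t k ⊆ picked sel t l :=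
  Finset.image_subset_image (Finset.range_mono h)

lemma FollowsConsUCB.sum_picked (h : FollowsConsUCB x K T α sel r) {t : ℕ} (ht : t < T)
    (f : Fin N → ℝ) : ∑ i ∈ picked sel t K, f i = ∑ k ∈ Finset.range K, f (sel t k) :=
  Finset.sum_image (h.injOn ht)

/-- Regret of one period, given valid confidence intervals. -/
lemma FollowsConsUCB.period_regret_le (h : FollowsConsUCB x K T α sel r) (hα : 0 ≤ α)
    (hS : S.card = K) {t : ℕ} (ht : t < T)
    (hconf : ∀ i, |(x i).ofLp ⬝ᵥ estimate x K sel r t - mean x θ i| ≤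
      α * width (designMatrix x K sel t) (x i)) :
    ∑ i ∈ S, mean x θ i - ∑ i ∈ picked sel t K, mean x θ i ≤
      2 * α * widthSum x K sel t + 2 * α * ∑ i ∈ S, (width (designMatrix x K sel t) (x i)
        - width (designMatrix x K sel (t + 1)) (x i)) := by
  have key := sum_le_sum_range_of_exchange (S := S) (s := sel t) hS (h.injOn ht)
    (f := fun i => mean x θ i - 2 * α * (width (designMatrix x K sel t) (x i)
        - width (designMatrix x K sel (t + 1)) (x i)))
    (g := fun k => mean x θ (sel t k) + 2 * α * width (stepMatrix x K sel t k) (x (sel t k))) ?_ ?_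
  · simp only [Finset.sum_sub_distrib, Finset.sum_add_distrib, ← Finset.mul_sum] at key
    rw [h.sum_picked ht, widthSum, Finset.sum_sub_distrib]
    linarith
  -- A left-out `i` was available at every step `k`, so its score lost there. The lower confidence
  -- bound at `i`, the upper one at `sel t k`, and `w_{t+1}(i)` below the current width of `i` give
  -- the claim.
  · intro i _ hi k hk
    have hscore := (h t ht k hk).2 i fun hmem => hi (picked_mono hk.le hmem)
    have h1 := (abs_le.1 (hconf i)).1
    have h2 := (abs_le.1 (hconf (sel t k))).2
    have h3 := mul_le_mul_of_nonneg_left (h.width_succ_le ht hk.le (x i)) hα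
    simp only [score] at hscore
    linarith
  · intro k hk _
    have h1 := mul_nonneg hα (sub_nonneg.2 (h.width_succ_le ht K.zero_le (x (sel t k))))
    have h2 := mul_nonneg hα (width_nonneg (stepMatrix x K sel t k) (x (sel t k)))
    simp only [stepMatrix] at h1
    linarith

/-- After the first period the widths of any `K` products are controlled by those of the selected
ones: the initial estimate vanishes. -/
lemma FollowsConsUCB.sum_width_one_le (h : FollowsConsUCB x K T α sel r) (hx : IsInstance x θ)
    (hα : 0 < α) (hS : S.card = K) (hT : 0 < T) :
    ∑ i ∈ S, 2 * width (designMatrix x K sel 1) (x i) ≤ K + 2 * widthSum x K sel 0 := by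
  have key := sum_le_sum_range_of_exchange (S := S) (s := sel 0) hS (h.injOn hT)
    (f := fun i => 2 * width (designMatrix x K sel 1) (x i))
    (g := fun k => 1 + 2 * width (stepMatrix x K sel 0 k) (x (sel 0 k))) ?_ ?_
  · simpa [Finset.sum_add_distrib, ← Finset.mul_sum, widthSum] using key
  · intro i _ hi k hk
    have hscore := (h 0 hT k hk).2 i fun hmem => hi (picked_mono hk.le hmem)
    have h1 := h.width_succ_le hT hk.le (x i)
    have h2 : width (designMatrix x K sel 0) (x i) ≤ 1 :=
      (width_stepMatrix_le_norm 0 0 (x i)).trans (hx.norm_feature_le i)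
    have h3 := width_nonneg (designMatrix x K sel 0) (x (sel 0 k))
    simp only [score, estimate, responseVector, Matrix.mulVec_zero, dotProduct_zero] at hscore
    -- The estimates in both scores are zero; the conservative term costs at most `α` for `i` since
    -- its initial width is at most 1, and only helps for the selected product.
    have h4 : α * (2 * width (stepMatrix x K sel 0 k) (x i)) ≤
        α * (1 + 2 * width (stepMatrix x K sel 0 k) (x (sel 0 k))) := by
      nlinarith [mul_le_mul_of_nonneg_left h2 hα.le, mul_nonneg hα.le h3]
    have h5 := le_of_mul_le_mul_left h4 hα
    linarith
  · intro k hk _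
    have h1 := h.width_succ_le hT hk.le (x (sel 0 k))
    linarith

lemma period_regret_le_card (hx : IsInstance x θ) (hS : S.card = K) (t : ℕ) :
    ∑ i ∈ S, mean x θ i - ∑ i ∈ picked sel t K, mean x θ i ≤ K := by
  have h1 : ∑ i ∈ S, mean x θ i ≤ K := by
    simpa [hS] using Finset.sum_le_card_nsmul S _ 1 fun i _ => hx.mean_le_one i
  have h2 := Finset.sum_nonneg fun i (_ : i ∈ picked sel t K) => hx.mean_nonneg i
  linarith

/-- Regret over all periods, given valid confidence intervals. -/
lemma FollowsConsUCB.regret_le (h : FollowsConsUCB x K T α sel r) (hx : IsInstance x θ)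
    (hα : 0 < α) (hS : S.card = K) (hT : 0 < T)
    (hconf : ∀ t < T, ∀ i, |(x i).ofLp ⬝ᵥ estimate x K sel r t - mean x θ i| ≤
      α * width (designMatrix x K sel t) (x i)) :
    regret x θ K T S sel ≤ K + α * K + 2 * α * ∑ t ∈ Finset.range T, widthSum x K sel t := by
  -- The first period is split off so that the telescope starts at `w_1`; starting from the initial
  -- widths, which may all equal 1, would cost `2αK` in place of `K + αK`.
  obtain ⟨T, rfl⟩ : ∃ T', T = T' + 1 := ⟨T - 1, by omega⟩
  rw [regret, ← Finset.sum_sub_distrib, Finset.sum_range_succ', Finset.sum_range_succ']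
  have h1 := Finset.sum_le_sum fun t (ht : t ∈ Finset.range T) =>
    h.period_regret_le (θ := θ) hα.le hS (t := t + 1) (by have := Finset.mem_range.1 ht; omega)
      (hconf (t + 1) (by have := Finset.mem_range.1 ht; omega))
  rw [Finset.sum_add_distrib, ← Finset.mul_sum, ← Finset.mul_sum, Finset.sum_comm] at h1
  have h2 : ∀ i, ∑ t ∈ Finset.range T, (width (designMatrix x K sel (t + 1)) (x i)
      - width (designMatrix x K sel (t + 1 + 1)) (x i)) ≤ width (designMatrix x K sel 1) (x i) := by
    intro i
    rw [Finset.sum_range_sub' fun t => width (designMatrix x K sel (t + 1)) (x i)]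
    exact sub_le_self _ (width_nonneg _ _)
  have h3 := mul_le_mul_of_nonneg_left (Finset.sum_le_sum fun i (_ : i ∈ S) => h2 i)
    (by positivity : 0 ≤ 2 * α)
  have h4 := mul_le_mul_of_nonneg_left (h.sum_width_one_le hx hα hS hT) hα.le
  rw [← Finset.mul_sum] at h4
  have h5 := period_regret_le_card (sel := sel) hx hS 0
  linarith

/-! ### The elliptical potential -/

lemma FollowsConsUCB.sum_width_sq_le (h : FollowsConsUCB x K T α sel r) (hx : IsInstance x θ)
    {t : ℕ} (ht : t < T) :
    ∑ k ∈ Finset.range K, width (stepMatrix x K sel t k) (x (sel t k)) ^ 2 ≤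
      2 * (Real.log (designMatrix x K sel (t + 1)).det
        - Real.log (designMatrix x K sel t).det) := by
  have hstep : ∀ k, width (stepMatrix x K sel t k) (x (sel t k)) ^ 2 ≤
      2 * (Real.log (stepMatrix x K sel t (k + 1)).det
        - Real.log (stepMatrix x K sel t k).det) := by
    intro k
    have hA := posDef_stepMatrix (x := x) (K := K) (sel := sel) t k
    have h1 : width (stepMatrix x K sel t k) (x (sel t k)) ^ 2 ≤ 1 :=
      pow_le_one₀ (width_nonneg _ _)
        ((width_stepMatrix_le_norm t k _).trans (hx.norm_feature_le _))
    have h0 := sq_nonneg (width (stepMatrix x K sel t k) (x (sel t k)))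
    have hdet : (stepMatrix x K sel t (k + 1)).det = (stepMatrix x K sel t k).det *
        (1 + width (stepMatrix x K sel t k) (x (sel t k)) ^ 2) := by
      rw [width_sq hA]
      exact det_add_vecMulVec hA _
    generalize width (stepMatrix x K sel t k) (x (sel t k)) ^ 2 = u at *
    rw [hdet, Real.log_mul hA.det_pos.ne' (by positivity)]
    have h2 := Real.one_sub_inv_le_log_of_pos (by positivity : 0 < 1 + u)
    -- Uses `u ≤ 1`; combined with `h2` it gives `u ≤ 2 log(1 + u)`.
    have h3 : u / 2 ≤ 1 - (1 + u)⁻¹ := by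
      rw [show 1 - (1 + u)⁻¹ = u / (1 + u) by field_simp; ring]
      exact div_le_div_of_nonneg_left h0 (by positivity) (by linarith)
    linarith
  refine (Finset.sum_le_sum fun k _ => hstep k).trans ?_
  rw [← Finset.mul_sum, Finset.sum_range_sub fun k => Real.log (stepMatrix x K sel t k).det,
    h.stepMatrix_last ht]
  rfl

lemma trace_designMatrix_le (hx : IsInstance x θ) (t : ℕ) :
    (designMatrix x K sel t).trace ≤ d + K * t := by
  induction t with
  | zero => simp [designMatrix]
  | succ t ih =>
    rw [designMatrix, Matrix.trace_add, Matrix.trace_sum]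
    have h1 : ∑ i ∈ picked sel t K, (outer x i).trace ≤ (picked sel t K).card • (1 : ℝ) := by
      refine Finset.sum_le_card_nsmul _ _ _ fun i _ => ?_
      rw [outer, Matrix.trace_vecMulVec, dotProduct_self_ofLp]
      exact pow_le_one₀ (norm_nonneg _) (hx.norm_feature_le i)
    have h2 : ((picked sel t K).card : ℝ) ≤ K := by
      exact_mod_cast Finset.card_image_le.trans (Finset.card_range K).le
    simp only [nsmul_eq_mul, mul_one] at h1
    push_cast
    linarith

lemma log_det_designMatrix_le (hx : IsInstance x θ) (t : ℕ) :
    Real.log (designMatrix x K sel t).det ≤ d * Real.log (1 + K * t) := by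
  simpa using log_det_le (posDef_designMatrix t) (m := K * t) (by positivity)
    (by simpa using trace_designMatrix_le hx t)

/-- Cauchy–Schwarz over the `KT` selections, whose squared widths telescope to twice the final
log-determinant. -/
lemma FollowsConsUCB.sum_widthSum_le (h : FollowsConsUCB x K T α sel r) (hx : IsInstance x θ) :
    ∑ t ∈ Finset.range T, widthSum x K sel t ≤ √(2 * d * K * T * Real.log (1 + K * T)) := by
  refine Real.le_sqrt_of_sq_le ?_
  have h1 : ∑ t ∈ Finset.range T, ∑ k ∈ Finset.range K,
      width (stepMatrix x K sel t k) (x (sel t k)) ^ 2 ≤ 2 * (d * Real.log (1 + K * T)) := by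
    refine (Finset.sum_le_sum fun t ht => h.sum_width_sq_le hx (Finset.mem_range.1 ht)).trans ?_
    rw [← Finset.mul_sum, Finset.sum_range_sub fun t => Real.log (designMatrix x K sel t).det]
    have := log_det_designMatrix_le (K := K) (sel := sel) hx T
    simpa [designMatrix] using this
  have h2 := sq_sum_le_card_mul_sum_sq (s := Finset.range T ×ˢ Finset.range K)
    (f := fun p => width (stepMatrix x K sel p.1 p.2) (x (sel p.1 p.2)))
  rw [Finset.sum_product, Finset.sum_product, Finset.card_product, Finset.card_range,
    Finset.card_range, Nat.cast_mul] at h2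
  refine h2.trans ((mul_le_mul_of_nonneg_left h1 (by positivity)).trans (le_of_eq ?_))
  ring

/-! ### Confidence intervals -/

/-- The means contribute `∑ xᵢxᵢᵀθ`, and that sum of outer products is the design matrix minus its
initial identity; the leftover `-θ` is the regularization bias. -/
lemma responseVector_eq (t : ℕ) :
    responseVector x K sel r t = noiseVector x θ K sel r t
      + (Matrix.mulVec (designMatrix x K sel t) θ.ofLp - θ.ofLp) := by
  induction t with
  | zero => simp [responseVector, noiseVector, designMatrix]
  | succ t ih =>
    have h1 : Matrix.mulVec (∑ i ∈ picked sel t K, outer x i) θ.ofLp =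
        ∑ i ∈ picked sel t K, mean x θ i • (x i).ofLp := by
      rw [Matrix.sum_mulVec]
      refine Finset.sum_congr rfl fun i _ => ?_
      rw [mean_eq_dotProduct]
      ext j
      simp [outer, Matrix.vecMulVec_mulVec, mul_comm]
    have h2 : noiseVector x θ K sel r (t + 1) = noiseVector x θ K sel r t
        + ∑ i ∈ picked sel t K, (r t i - mean x θ i) • (x i).ofLp := rfl
    rw [responseVector, ih, designMatrix, Matrix.add_mulVec, h1, h2]
    simp only [sub_smul, Finset.sum_sub_distrib]
    abel

lemma abs_estimate_sub_mean_le (hx : IsInstance x θ) (t : ℕ) (i : Fin N) :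
    |(x i).ofLp ⬝ᵥ estimate x K sel r t - mean x θ i| ≤
      (√(invForm (designMatrix x K sel t) (noiseVector x θ K sel r t) (noiseVector x θ K sel r t))
        + 1) * width (designMatrix x K sel t) (x i) := by
  have hA := posDef_designMatrix (x := x) (K := K) (sel := sel) t
  set A := designMatrix x K sel t
  set s := noiseVector x θ K sel r t
  have h1 : (x i).ofLp ⬝ᵥ estimate x K sel r t - mean x θ i =
      invForm A (x i).ofLp s - invForm A (x i).ofLp θ.ofLp := by
    rw [estimate, responseVector_eq (θ := θ), Matrix.mulVec_add, Matrix.mulVec_sub,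
      Matrix.mulVec_mulVec, Matrix.nonsing_inv_mul _ hA.det_pos.ne'.isUnit, Matrix.one_mulVec,
      dotProduct_add, dotProduct_sub, mean_eq_dotProduct]
    simp only [invForm, A, s]
    ring
  have h2 : √(invForm A θ.ofLp θ.ofLp) ≤ 1 := by
    rw [Real.sqrt_le_one]
    refine (invForm_designMatrix_self_le t _).trans ?_
    rw [dotProduct_self_ofLp]
    exact pow_le_one₀ (norm_nonneg _) hx.norm_param_le
  rw [h1]
  refine (abs_sub _ _).trans ?_
  have h3 := abs_invForm_le hA (x i).ofLp s
  have h4 := (abs_invForm_le hA (x i).ofLp θ.ofLp).trans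
    (mul_le_mul_of_nonneg_left h2 (Real.sqrt_nonneg _))
  change _ ≤ (√(invForm A s s) + 1) * √(invForm A (x i).ofLp (x i).ofLp)
  linarith

end Path

/-! ### Numerical estimates and assembly of the bound. -/

section Bound

variable {d N K T : ℕ} {δ : ℝ}

lemma one_le_log_ratio (hN : 1 ≤ N) (hT : 1 ≤ T) (hδ : 0 < δ) (hδ1 : δ < 1) :
    1 ≤ Real.log ((1 + N + T * N) / δ) := by
  have hN' : (1 : ℝ) ≤ N := by exact_mod_cast hN
  have hT' : (1 : ℝ) ≤ T := by exact_mod_cast hT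
  -- `1 + N + TN ≥ 3 > e`, so the logarithm is at least 1 and its powers can absorb constants.
  have h3 : (3 : ℝ) ≤ (1 + N + T * N) / δ := by
    rw [le_div_iff₀ hδ]; nlinarith
  rw [Real.le_log_iff_exp_le (by linarith)]
  exact Real.exp_one_lt_three.le.trans h3

lemma one_le_alpha : 1 ≤ alpha d N T δ :=
  le_add_of_nonneg_left (Real.sqrt_nonneg _)

lemma alpha_le (hd : 1 ≤ d) (hL : 1 ≤ Real.log ((1 + N + T * N) / δ)) :
    alpha d N T δ ≤ 2 * √d * √(Real.log ((1 + N + T * N) / δ)) := by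
  have h1 : (1 : ℝ) ≤ √d := Real.one_le_sqrt.2 (by exact_mod_cast hd)
  have h2 := Real.one_le_sqrt.2 hL
  rw [alpha, Real.sqrt_mul (by positivity)]
  nlinarith

lemma fixedCost_le (hd : 1 ≤ d) (hL : 1 ≤ Real.log ((1 + N + T * N) / δ)) :
    (K : ℝ) + alpha d N T δ * K ≤ 3 * (K * √d) * Real.log ((1 + N + T * N) / δ) := by
  have hα := alpha_le hd hL
  generalize Real.log ((1 + N + T * N) / δ) = L at *
  have h1 : (1 : ℝ) ≤ √d := Real.one_le_sqrt.2 (by exact_mod_cast hd)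
  have h2 : √L ≤ L := Real.sqrt_le_iff.2 ⟨by linarith, by nlinarith⟩
  have h3 : 2 * √d * √L ≤ 2 * √d * L := by gcongr
  have h4 : 1 ≤ √d * L := by nlinarith
  have h5 : 1 + alpha d N T δ ≤ 3 * √d * L := by linarith
  have := mul_le_mul_of_nonneg_left h5 K.cast_nonneg
  linarith

lemma regretBound_le (hd : 1 ≤ d) (hK : 1 ≤ K) (hKN : K ≤ N) (hT : 1 ≤ T) (hδ : 0 < δ)
    (hδ1 : δ < 1) :
    regretBound d K T (alpha d N T δ) ≤
      20 * (K * √d + d * √((K : ℝ) * T)) * Real.log ((1 + N + T * N) / δ) := by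
  have hL := one_le_log_ratio (hK.trans hKN) hT hδ hδ1
  have hα := alpha_le hd hL
  have hfix := fixedCost_le (K := K) hd hL
  have hK' : (1 : ℝ) ≤ K := by exact_mod_cast hK
  have hT' : (1 : ℝ) ≤ T := by exact_mod_cast hT
  have hKN' : (K : ℝ) ≤ N := by exact_mod_cast hKN
  have hlog : Real.log (K * T) ≤ Real.log ((1 + N + T * N) / δ) := by
    refine Real.log_le_log (by positivity) ?_
    rw [le_div_iff₀ hδ]
    nlinarith [mul_le_mul_of_nonneg_right hKN' (zero_le_one.trans hT'),
      mul_pos (zero_lt_one.trans_le hK') (zero_lt_one.trans_le hT')]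
  generalize Real.log ((1 + N + T * N) / δ) = L at *
  have h1 : √((d : ℝ) * K * T * Real.log (K * T)) ≤ √d * √((K : ℝ) * T) * √L := by
    rw [← Real.sqrt_mul (by positivity), ← Real.sqrt_mul (by positivity), ← mul_assoc (d : ℝ)]
    gcongr
  have h2 : alpha d N T δ * √((d : ℝ) * K * T * Real.log (K * T)) ≤
      (2 * √d * √L) * (√d * √((K : ℝ) * T) * √L) := by gcongr
  have h3 : (2 * √d * √L) * (√d * √((K : ℝ) * T) * √L) = 2 * (d * √((K : ℝ) * T)) * L := by
    rw [show (2 * √d * √L) * (√d * √((K : ℝ) * T) * √L) =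
      2 * ((√d * √d) * √((K : ℝ) * T)) * (√L * √L) by ring, Real.mul_self_sqrt (by positivity),
      Real.mul_self_sqrt (by linarith)]
  have h4 : 0 ≤ K * √d * L := by positivity
  rw [regretBound]
  linarith

/-- Matches the radius to `alpha`: `1 + Kt ≤ 1 + N + TN`, and `d ≥ 1` allows `log(1/δ)` to be
replaced by `d log(1/δ)`. -/
lemma noise_bound_le (hd : 1 ≤ d) (hKN : K ≤ N) (hδ : 0 < δ) (hδ1 : δ < 1) {t : ℕ}
    (ht : t ≤ T) :
    d * Real.log (1 + K * t) + Real.log (1 / δ) ≤ d * Real.log ((1 + N + T * N) / δ) := by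
  have hKN' : (K : ℝ) ≤ N := by exact_mod_cast hKN
  have ht' : (t : ℝ) ≤ T := by exact_mod_cast ht
  have hd' : (1 : ℝ) ≤ d := by exact_mod_cast hd
  have h1 : Real.log (1 + K * t) ≤ Real.log (1 + N + T * N) := by
    refine Real.log_le_log (by positivity) ?_
    have : (K : ℝ) * t ≤ N * T := by gcongr
    have : (0 : ℝ) ≤ N := N.cast_nonneg
    linarith
  have h2 : 0 ≤ Real.log (1 / δ) := Real.log_nonneg (by rw [le_div_iff₀ hδ]; linarith)
  rw [div_eq_mul_one_div (1 + N + T * N : ℝ), Real.log_mul (by positivity) (by positivity), mul_add]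
  exact add_le_add (by gcongr) (le_mul_of_one_le_left h2 hd')

variable {x : Fin N → EuclideanSpace ℝ (Fin d)} {θ : EuclideanSpace ℝ (Fin d)}
  {sel : ℕ → ℕ → Fin N} {r : ℕ → Fin N → ℝ} {α : ℝ} {S : Finset (Fin N)}

lemma regret_le_of_one_period (hx : IsInstance x θ) (hS : S.card = K) (hα : 0 ≤ α) :
    regret x θ K 1 S sel ≤ regretBound d K 1 α := by
  have h1 := period_regret_le_card (sel := sel) hx hS 0
  have h2 : 0 ≤ 10 * α * √((d : ℝ) * K * (1 : ℕ) * Real.log (K * (1 : ℕ))) := by positivity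
  have h3 : 0 ≤ α * K := by positivity
  simp only [regret, regretBound, Finset.sum_range_one]
  linarith

lemma FollowsConsUCB.regret_le_regretBound (h : FollowsConsUCB x K T α sel r)
    (hx : IsInstance x θ) (hα : 0 < α) (hS : S.card = K) (hK : 1 ≤ K) (hT : 1 ≤ T)
    (hconf : ∀ t < T, ∀ i, |(x i).ofLp ⬝ᵥ estimate x K sel r t - mean x θ i| ≤
      α * width (designMatrix x K sel t) (x i)) :
    regret x θ K T S sel ≤ regretBound d K T α := by
  -- For `K = T = 1` the factor `log(KT)` vanishes, so one period is covered by the term `K` alone;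
  -- otherwise `KT ≥ 2`.
  obtain rfl | hT2 := hT.eq_or_lt
  · exact regret_le_of_one_period hx hS hα.le
  refine (h.regret_le hx hα hS hT hconf).trans ?_
  have hK' : (1 : ℝ) ≤ K := by exact_mod_cast hK
  have hT' : (2 : ℝ) ≤ T := by exact_mod_cast hT2
  have hm : (2 : ℝ) ≤ K * T := by nlinarith
  -- `1 + m ≤ m²` for `m ≥ 2`. The resulting factor is `2α · 2 = 4α`, within the allowed `10α`.
  have hlog : Real.log (1 + K * T) ≤ 2 * Real.log (K * T) := by
    rw [← Real.log_rpow (by positivity)]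
    refine Real.log_le_log (by positivity) ?_
    norm_num
    nlinarith
  have hlog0 : 0 ≤ Real.log (K * T) := Real.log_nonneg (by linarith)
  have h1 : √(2 * d * K * T * Real.log (1 + K * T)) ≤
      2 * √((d : ℝ) * K * T * Real.log (K * T)) := by
    refine Real.sqrt_le_iff.2 ⟨by positivity, ?_⟩
    rw [mul_pow, Real.sq_sqrt (by positivity)]
    have := mul_le_mul_of_nonneg_left hlog (by positivity : (0 : ℝ) ≤ 2 * d * K * T)
    linarith
  have h2 := mul_le_mul_of_nonneg_left ((h.sum_widthSum_le hx).trans h1)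
    (by positivity : 0 ≤ 2 * α)
  have h3 : 0 ≤ α * √((d : ℝ) * K * T * Real.log (K * T)) := by positivity
  rw [regretBound]
  linarith

end Bound

end SemiBandit

/-- The constants `C` and `p` are universal: they make the `Õ` claims precise, the hidden factor
being a power of `log((1 + N + T N) / δ)`. -/
theorem theorem2 :
    ∃ (C : ℝ) (p : ℕ), ∀ (d N K T : ℕ) (δ : ℝ), 1 ≤ d → 1 ≤ K → K ≤ N → 1 ≤ T → 0 < δ → δ < 1 →
      (∀ (x : Fin N → EuclideanSpace ℝ (Fin d)) (θ : EuclideanSpace ℝ (Fin d))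
          (Sopt : Finset (Fin N)) (Ω : Type*) (mΩ : MeasurableSpace Ω) (P : Measure Ω)
          (ℱ : Filtration ℕ mΩ) (r : ℕ → Fin N → Ω → ℝ) (sel : ℕ → ℕ → Ω → Fin N),
        IsProbabilityMeasure P →
        SemiBandit.IsInstance x θ →
        SemiBandit.IsOptimalSet x θ K Sopt →
        SemiBandit.IsSalesProcess P ℱ T x θ r →
        SemiBandit.IsConsUCBRun ℱ K T (SemiBandit.alpha d N T δ) x r sel →
        1 - δ ≤ P.real {ω | SemiBandit.regret x θ K T Sopt (fun t k => sel t k ω) ≤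
          SemiBandit.regretBound d K T (SemiBandit.alpha d N T δ)}) ∧
      SemiBandit.regretBound d K T (SemiBandit.alpha d N T δ) ≤
        C * (K * √(d : ℝ) + d * √((K : ℝ) * T)) * Real.log ((1 + N + T * N) / δ) ^ p ∧
      (K : ℝ) + SemiBandit.alpha d N T δ * K ≤
        C * (K * √(d : ℝ)) * Real.log ((1 + N + T * N) / δ) ^ p := by
  open SemiBandit in
  -- `20 = 10 · 2`: the 2 comes from `alpha ≤ 2√d√L` with `L` the logarithm, and the other `√L` from
  -- `√(log(KT))`, so `p = 1`. The fixed cost needs only 3.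
  refine ⟨20, 1, fun d N K T δ hd hK hKN hT hδ hδ1 => ⟨?_, ?_, ?_⟩⟩
  · intro x θ Sopt Ω mΩ P ℱ r sel hP hx hopt hS hrun
    refine (measureReal_noise_le hx hS hrun hδ).trans (measureReal_mono fun ω hω => ?_)
    refine (hrun.follows ω).regret_le_regretBound hx (zero_lt_one.trans_le one_le_alpha) hopt.1
      hK hT fun t ht i => (abs_estimate_sub_mean_le hx t i).trans ?_
    refine mul_le_mul_of_nonneg_right (add_le_add_left (Real.sqrt_le_sqrt ?_) 1) (width_nonneg _ _)
    have h1 := log_det_designMatrix_le (K := K) (sel := fun t k => sel t k ω) hx t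
    have h2 := noise_bound_le hd hKN hδ hδ1 ht.le
    linarith [hω t ht.le]
  · rw [pow_one]
    exact regretBound_le hd hK hKN hT hδ hδ1
  · have hL := one_le_log_ratio (hK.trans hKN) hT hδ hδ1
    refine (fixedCost_le hd hL).trans ?_
    rw [pow_one]
    have : 0 ≤ K * √(d : ℝ) * Real.log ((1 + N + T * N) / δ) := by positivity
    linarith
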